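/- **Conventions.** Semirings are commutative with $1$; morphisms of semirings preserve $0$ and $1$. A semiring $S$ is *idempotent* if $a+a=a$ for all $a\in S$. A *$k$-ideal* of $S$ is an ideal $I$ such that $a+c=b$ with $a,b\in I$ implies $c\in I$; it is *prime* if $S\smallsetminus I$ is multiplicatively closed (and contains $1$). A semiring is *local* if it has a unique maximal (proper) $k$-ideal, and a morphism of local semirings is *local* if it maps the maximal $k$-ideal of the source into that of the target. A semiring $T$ is *realizable* if it is isomorphic to the semiring $\mathrm{fgId}(R)$ of finitely generated ideals (under sum and product of ideals) of some commutative ring $R$ with $1$. A *locally idempotent semiringed space* is a topological space $X$ with a sheaf $\mathcal O_X$ of idempotent semirings all of whose stalks are local. A *morphism* $(Y,\mathcal O_Y)\to(X,\mathcal O_X)$ is a continuous map $f:Y\to X$ with a morphism of sheaves of semirings $f^\sharp:\mathcal O_X\to f_*\mathcal O_Y$ such that for each $y\in Y$ the induced map $\mathcal O_{X,f(y)}\to\mathcal O_{Y,y}$ is local. For a realizable semiring $T$, let $\mathrm{Spec}_k(T)$ be the set of prime $k$-ideals of $T$ with the topology whose closed sets are $V_k(X)=\{\mathfrak p: X\subseteq\mathfrak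 p\}$, $X\subseteq T$, and with the structure sheaf $\mathcal O$ for which $\mathcal O(U)$ is the semiring of functions $s:U\to\bigsqcup_{\mathfrak p\in U}T_{\mathfrak p}$ with $s(\mathfrak p)\in T_{\mathfrak p}$ that are locally fractions: each $\mathfrak p\in U$ has an open neighbourhood $V\subseteq U$ and $a,f\in T$ such that $f\notin\mathfrak q$ and $s(\mathfrak q)=a/f$ in $T_{\mathfrak q}$ for all $\mathfrak q\in V$. A *tropical affine scheme* is a locally idempotent semiringed space isomorphic to $\mathrm{Spec}_k(T)$ for some realizable semiring $T$. **Theorem 4.9.** The category of tropical affine schemes is equivalent to the opposite of the category of realizable semirings (with all semiring morphisms). The equivalence is given by the functor that associates to a tropical affine scheme the global sections of its structure sheaf: $\mathcal O_X(X)$ is realizable for each tropical affine scheme $X$, and $X\mapsto\mathcal O_X(X)$ is an equivalence of categories. Moreover, if $X_i$ is a tropical affine scheme isomorphic to $\mathrm{Spec}_k(T_i)$ with $T_i$ realizable $(i=1,2)$, then there is a bijection $\mathrm{Hom}(T_1,T_2)\cong\mathrm{Hom}(X_2,X_1)$. -/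

import Mathlib

open CategoryTheory TopologicalSpace Opposite
open AlgebraicGeometry (SheafedSpace PresheafedSpace)

universe u

noncomputable section

/-! ### Subtractive ideals, `k`-local semirings, realizable semirings

Throughout, "semiring" means commutative semiring with unit, and morphisms of semirings
preserve `0` and `1`. -/

/-- A semiring is idempotent if `a + a = a` for all `a`. -/
def IsIdempotentSemiring (S : Type*) [CommSemiring S] : Prop :=
  ∀ a : S, a + a = a

/-- A `k`-ideal (subtractive ideal): if `a + c = b` with `a, b ∈ I`, then `c ∈ I`. -/
def IsKIdeal {S : Type*} [CommSemiring S] (I : Ideal S) : Prop :=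
  ∀ a b c : S, a ∈ I → b ∈ I → a + c = b → c ∈ I

/-- A maximal `k`-ideal: a maximal element among the proper `k`-ideals. -/
structure IsMaximalKIdeal {S : Type*} [CommSemiring S] (M : Ideal S) : Prop where
  isKIdeal : IsKIdeal M
  ne_top : M ≠ ⊤
  eq_of_le : ∀ I : Ideal S, IsKIdeal I → I ≠ ⊤ → M ≤ I → I = M

/-- A semiring is (`k`-)local if it has a unique maximal `k`-ideal. -/
def IsKLocal (S : Type*) [CommSemiring S] : Prop :=
  ∃! M : Ideal S, IsMaximalKIdeal M

/-- A morphism of local semirings is local if it maps the maximal `k`-ideal of the source into the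
maximal `k`-ideal of the target. -/
def IsKLocalHom {S S' : Type*} [CommSemiring S] [CommSemiring S'] (φ : S →+* S') : Prop :=
  ∀ (M : Ideal S) (M' : Ideal S'), IsMaximalKIdeal M → IsMaximalKIdeal M' → ∀ a ∈ M, φ a ∈ M'

/-- The semiring `fgId(R)` of finitely generated ideals of a commutative ring `R`, under sum and
product of ideals. -/
def fgId (R : Type*) [CommRing R] : Subsemiring (Ideal R) where
  carrier := {I | I.FG}
  zero_mem' := Submodule.fg_bot
  one_mem' := Ideal.one_eq_top (R := R) ▸ Ideal.fg_top R
  add_mem' hI hJ := Submodule.FG.sup hI hJ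
  mul_mem' hI hJ := Submodule.FG.mul hI hJ

/-- A semiring is realizable if it is isomorphic to the semiring of finitely generated ideals
of some commutative ring. (Such a semiring is automatically idempotent, see
`IsRealizable.isIdempotentSemiring`.) -/
def IsRealizable (T : Type u) [CommSemiring T] : Prop :=
  ∃ (R : Type u) (_ : CommRing R), Nonempty (T ≃+* fgId R)

theorem IsRealizable.isIdempotentSemiring {T : Type u} [CommSemiring T] (h : IsRealizable T) :
    IsIdempotentSemiring T := by
  obtain ⟨R, _, ⟨e⟩⟩ := h
  intro a
  apply e.injective
  rw [map_add]
  exact Subtype.ext (sup_idem _)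

/-! ### The space `Spec_k(T)` and its structure sheaf -/

/-- The set of prime `k`-ideals of `T`. As a subtype of `PrimeSpectrum T` it carries the subspace
topology, which is the Zariski topology, see `KSpec.isClosed_iff`. -/
abbrev KSpec (T : Type u) [CommSemiring T] : Type u :=
  {p : PrimeSpectrum T // IsKIdeal p.asIdeal}

/-- The closed subsets of `KSpec T` are exactly the sets `V_k(X) = {p | X ⊆ p}`, `X ⊆ T`. -/
theorem KSpec.isClosed_iff {T : Type u} [CommSemiring T] (Z : Set (KSpec T)) :
    IsClosed Z ↔ ∃ X : Set T, Z = {p | X ⊆ p.1.asIdeal} := by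
  rw [isClosed_induced_iff]
  constructor
  · rintro ⟨Y, hY, rfl⟩
    obtain ⟨X, rfl⟩ := (PrimeSpectrum.isClosed_iff_zeroLocus Y).1 hY
    exact ⟨X, rfl⟩
  · rintro ⟨X, rfl⟩
    exact ⟨PrimeSpectrum.zeroLocus X, PrimeSpectrum.isClosed_zeroLocus X, rfl⟩

namespace SpecK

variable (T : Type u) [CommSemiring T]

/-- The underlying topological space of `Spec_k(T)`. -/
abbrev Top : TopCat.{u} := TopCat.of (KSpec T)

/-- The family of localizations `T_p`. -/
abbrev Loc (p : Top T) : Type u := Localization.AtPrime p.1.asIdeal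

/-- The predicate saying that a dependent function on `U` is given by one fraction `a / f` with
`f` outside of each prime in `U`. -/
def isFractionPrelocal : TopCat.PrelocalPredicate (Loc T) where
  pred {U} s := ∃ a f : T, ∀ q : U, ∃ hf : f ∉ q.1.1.asIdeal, s q = Localization.mk a ⟨f, hf⟩
  res := by
    rintro V U i s ⟨a, f, h⟩
    exact ⟨a, f, fun q => h ⟨q.1, i.le q.2⟩⟩

/-- The predicate saying that a dependent function on `U` is locally a fraction: each `p ∈ U` has
an open neighbourhood `V ⊆ U` on which the function is a fraction. -/
def isLocallyFraction : TopCat.LocalPredicate (Loc T) := (isFractionPrelocal T).sheafify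

/-- The semiring of sections over `U`, with pointwise operations. -/
def sections (U : Opens (Top T)) : Subsemiring (∀ p : U, Loc T p.1) where
  carrier := {s | (isLocallyFraction T).pred s}
  zero_mem' p := ⟨U, p.2, 𝟙 _, 0, 1, fun q =>
    ⟨q.1.1.asIdeal.ne_top_iff_one.1 q.1.1.isPrime.ne_top, (Localization.mk_zero _).symm⟩⟩
  one_mem' p := ⟨U, p.2, 𝟙 _, 1, 1, fun q =>
    ⟨q.1.1.asIdeal.ne_top_iff_one.1 q.1.1.isPrime.ne_top, Localization.mk_one.symm⟩⟩
  add_mem' {s t} hs ht p := by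
    obtain ⟨V, hpV, i, a, f, h⟩ := hs p
    obtain ⟨W, hpW, j, b, g, k⟩ := ht p
    refine ⟨V ⊓ W, ⟨hpV, hpW⟩, homOfLE inf_le_left ≫ i, f * b + g * a, f * g, fun q => ?_⟩
    obtain ⟨hf, e⟩ := h ⟨q.1, q.2.1⟩
    obtain ⟨hg, e'⟩ := k ⟨q.1, q.2.2⟩
    exact ⟨q.1.1.asIdeal.primeCompl.mul_mem hf hg,
      congr($e + $e').trans (Localization.add_mk ..)⟩
  mul_mem' {s t} hs ht p := by
    obtain ⟨V, hpV, i, a, f, h⟩ := hs p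
    obtain ⟨W, hpW, j, b, g, k⟩ := ht p
    refine ⟨V ⊓ W, ⟨hpV, hpW⟩, homOfLE inf_le_left ≫ i, a * b, f * g, fun q => ?_⟩
    obtain ⟨hf, e⟩ := h ⟨q.1, q.2.1⟩
    obtain ⟨hg, e'⟩ := k ⟨q.1, q.2.2⟩
    exact ⟨q.1.1.asIdeal.primeCompl.mul_mem hf hg,
      congr($e * $e').trans (Localization.mk_mul ..)⟩

/-- The structure presheaf, with the restriction of functions as restriction maps. -/
def structurePresheaf : TopCat.Presheaf CommSemiRingCat.{u} (Top T) where
  obj U := CommSemiRingCat.of (sections T U.unop)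
  map i := CommSemiRingCat.ofHom
    { toFun s := ⟨fun q => s.1 ⟨q.1, i.unop.le q.2⟩, (isLocallyFraction T).res i.unop s.1 s.2⟩
      map_zero' := rfl
      map_one' := rfl
      map_add' _ _ := rfl
      map_mul' _ _ := rfl }

theorem structurePresheaf_isSheaf : (structurePresheaf T).IsSheaf :=
  (TopCat.Presheaf.isSheaf_iff_isSheaf_comp (forget CommSemiRingCat.{u}) _).2
    (TopCat.Presheaf.isSheaf_of_iso
      (F := (TopCat.subsheafToTypes (isLocallyFraction T)).1)
      (NatIso.ofComponents (fun _ => Iso.refl (sections T _ : Type u)) (fun _ => rfl))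
      (TopCat.subsheafToTypes (isLocallyFraction T)).2)

/-- `Spec_k(T)` as a topological space with a sheaf of semirings. -/
def sheafedSpace : SheafedSpace CommSemiRingCat.{u} where
  carrier := Top T
  presheaf := structurePresheaf T
  IsSheaf := structurePresheaf_isSheaf T

end SpecK

/-! ### Colimits of commutative semirings

These are needed to speak about stalks. -/

namespace CommSemiRingColimit

variable {J : Type u} [SmallCategory J] (F : J ⥤ CommSemiRingCat.{u})

/-- The relations that present the colimit of `F` as a quotient of a polynomial semiring. -/
inductive Rel : MvPolynomial (Σ j, F.obj j) ℕ → MvPolynomial (Σ j, F.obj j) ℕ → Prop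
  | zero (j : J) : Rel (MvPolynomial.X ⟨j, 0⟩) 0
  | one (j : J) : Rel (MvPolynomial.X ⟨j, 1⟩) 1
  | add (j : J) (a b : F.obj j) :
      Rel (MvPolynomial.X ⟨j, a + b⟩) (MvPolynomial.X ⟨j, a⟩ + MvPolynomial.X ⟨j, b⟩)
  | mul (j : J) (a b : F.obj j) :
      Rel (MvPolynomial.X ⟨j, a * b⟩) (MvPolynomial.X ⟨j, a⟩ * MvPolynomial.X ⟨j, b⟩)
  | map {i j : J} (f : i ⟶ j) (a : F.obj i) :
      Rel (MvPolynomial.X ⟨j, F.map f a⟩) (MvPolynomial.X ⟨i, a⟩)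

/-- The congruence generated by the relations. -/
abbrev con : RingCon (MvPolynomial (Σ j, F.obj j) ℕ) := ringConGen (Rel F)

variable {F} in
theorem con_eq {a b} (h : Rel F a b) : (a : (con F).Quotient) = (b : (con F).Quotient) :=
  (RingCon.eq _).2 (RingConGen.Rel.of _ _ h)

/-- The colimit cocone. -/
def cocone : Limits.Cocone F where
  pt := CommSemiRingCat.of (con F).Quotient
  ι :=
    { app j := CommSemiRingCat.ofHom
        { toFun a := ((MvPolynomial.X ⟨j, a⟩ : MvPolynomial (Σ j, F.obj j) ℕ) : (con F).Quotient)
          map_zero' := con_eq (.zero j)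
          map_one' := con_eq (.one j)
          map_add' a b := con_eq (.add j a b)
          map_mul' a b := con_eq (.mul j a b) }
      naturality i j f := by
        ext a
        exact con_eq (.map f a) }

theorem con_le (s : Limits.Cocone F) :
    con F ≤ RingCon.ker (MvPolynomial.eval₂Hom (Nat.castRingHom s.pt)
      (fun x : Σ j, F.obj j => s.ι.app x.1 x.2)) := by
  refine RingCon.ringConGen_le.2 ?_
  rintro _ _ (j | j | ⟨j, a, b⟩ | ⟨j, a, b⟩ | ⟨f, a⟩)
  all_goals simp [RingCon.ker]

/-- The cocone is a colimit. -/
def isColimit : Limits.IsColimit (cocone F) where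
  desc s := CommSemiRingCat.ofHom (RingCon.lift (con F) _ (con_le F s))
  fac s j := by
    ext a
    exact MvPolynomial.eval₂Hom_X' _ _ _
  uniq s m h := by
    ext x
    obtain ⟨x, rfl⟩ := RingCon.mk'_surjective (con F) x
    have : m.hom.comp (RingCon.mk' (con F)) = MvPolynomial.eval₂Hom (Nat.castRingHom s.pt)
        (fun x : Σ j, F.obj j => s.ι.app x.1 x.2) := by
      apply MvPolynomial.ringHom_ext'
      · exact Subsingleton.elim _ _
      · rintro ⟨j, a⟩
        simp only [MvPolynomial.eval₂Hom_X']
        exact congr($(h j) a)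
    exact congr($this x)

end CommSemiRingColimit

instance CommSemiRingCat.hasColimits : Limits.HasColimits CommSemiRingCat.{u} where
  has_colimits_of_shape _ _ :=
    { has_colimit F := ⟨⟨_, CommSemiRingColimit.isColimit F⟩⟩ }

/-! ### Locally idempotent semiringed spaces -/

/-- A locally idempotent semiringed space: a topological space with a sheaf of idempotent
semirings all of whose stalks are local. -/
structure LocallyIdempotentSpace extends SheafedSpace CommSemiRingCat.{u} where
  idempotent : ∀ U : (Opens carrier)ᵒᵖ, IsIdempotentSemiring (presheaf.obj U)
  isKLocal : ∀ x : carrier, IsKLocal (presheaf.stalk x)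

namespace LocallyIdempotentSpace

/-- A morphism `X ⟶ Y`: a continuous map `f : X → Y` and a morphism of sheaves of semirings
`𝒪_Y → f_* 𝒪_X` such that the induced maps `𝒪_{Y, f x} → 𝒪_{X, x}` on stalks are local. -/
@[ext]
structure Hom (X Y : LocallyIdempotentSpace.{u}) : Type u
    extends X.toPresheafedSpace.Hom Y.toPresheafedSpace where
  prop : ∀ x : X.carrier, IsKLocalHom (toHom.stalkMap x).hom

instance : Category LocallyIdempotentSpace.{u} where
  Hom := Hom
  id X :=
    { toHom := 𝟙 X.toPresheafedSpace
      prop x M M' hM hM' a ha := by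
        rw [PresheafedSpace.stalkMap.id]
        exact (X.isKLocal x).unique hM hM' ▸ ha }
  comp {X Y Z} f g :=
    { toHom := (f.toHom ≫ g.toHom : X.toPresheafedSpace ⟶ Z.toPresheafedSpace)
      prop x M M' hM hM' a ha := by
        rw [PresheafedSpace.stalkMap.comp]
        obtain ⟨N, hN, -⟩ := Y.isKLocal (f.base x)
        exact f.prop x N M' hN hM' _ (g.prop (f.base x) M N hM hN a ha) }

/-- The functor that forgets that the stalks are local. -/
def forgetToSheafedSpace : LocallyIdempotentSpace.{u} ⥤ SheafedSpace CommSemiRingCat.{u} where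
  obj X := X.toSheafedSpace
  map f := InducedCategory.homMk f.toHom

/-- The functor of global sections. -/
def Γ : LocallyIdempotentSpace.{u}ᵒᵖ ⥤ CommSemiRingCat.{u} :=
  forgetToSheafedSpace.op ⋙ SheafedSpace.Γ

end LocallyIdempotentSpace

/-! ### `Spec_k(T)` as a locally idempotent semiringed space -/

namespace SpecK

variable (T : Type u) [CommSemiring T]

/-- The maps `𝒪(U) → T_p`, `s ↦ s(p)`, for `U` running through the neighbourhoods of `p`. -/
def evalCocone (p : Top T) :
    Limits.Cocone ((OpenNhds.inclusion p).op ⋙ structurePresheaf T) where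
  pt := CommSemiRingCat.of (Loc T p)
  ι :=
    { app U := CommSemiRingCat.ofHom
        ((Pi.evalRingHom (fun q : U.unop.1 => Loc T q.1) ⟨p, U.unop.2⟩).comp
          (sections T U.unop.1).subtype)
      naturality _ _ _ := rfl }

/-- Evaluation of germs at `p`, as a map from the stalk at `p` to `T_p`. -/
def stalkEval (p : Top T) :
    (structurePresheaf T).stalk p ⟶ CommSemiRingCat.of (Loc T p) :=
  Limits.colimit.desc _ (evalCocone T p)

variable {T}

theorem stalkEval_germ (p : Top T) (U : Opens (Top T)) (hp : p ∈ U)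
    (s : (structurePresheaf T).obj (op U)) :
    (stalkEval T p).hom (((structurePresheaf T).germ U p hp).hom s) =
      (show sections T U from s).1 ⟨p, hp⟩ :=
  congr($(Limits.colimit.ι_desc (evalCocone T p) (op ⟨U, hp⟩)) s)

theorem mk_mem_maximalIdeal {p : Top T} {a : T} {f : p.1.asIdeal.primeCompl} :
    (Localization.mk a f : Loc T p) ∈ IsLocalRing.maximalIdeal (Loc T p) ↔ a ∈ p.1.asIdeal := by
  rw [Localization.mk_eq_mk']
  exact IsLocalization.AtPrime.mk'_mem_maximal_iff (Loc T p) p.1.asIdeal a f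

theorem isKIdeal_maximalIdeal (p : Top T) :
    IsKIdeal (IsLocalRing.maximalIdeal (Loc T p)) := by
  rintro x y z hx hy rfl
  induction x using Localization.induction_on with | _ x
  induction z using Localization.induction_on with | _ z
  obtain ⟨a, f⟩ := x
  obtain ⟨c, g⟩ := z
  rw [Localization.add_mk, mk_mem_maximalIdeal] at hy
  rw [mk_mem_maximalIdeal] at hx ⊢
  have h := p.2 (g * a) _ (f * c) (p.1.asIdeal.mul_mem_left _ hx) hy (add_comm _ _)
  exact (p.1.isPrime.mem_or_mem h).resolve_left f.2

theorem isUnit_of_stalkEval (p : Top T) (s : (structurePresheaf T).stalk p)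
    (hs : (stalkEval T p).hom s ∉ IsLocalRing.maximalIdeal (Loc T p)) : IsUnit s := by
  obtain ⟨U, hp, s, rfl⟩ := TopCat.Presheaf.exists_germ_eq _ s
  obtain ⟨V, hpV, i, a, f, h⟩ := s.2 ⟨p, hp⟩
  have ha : a ∉ p.1.asIdeal := by
    obtain ⟨hf, e⟩ := h ⟨p, hpV⟩
    intro ha
    refine hs ?_
    have h1 := (stalkEval_germ p U hp s).trans e
    exact h1 ▸ mk_mem_maximalIdeal.2 ha
  let W : Opens (Top T) :=
    V ⊓ ⟨Subtype.val ⁻¹' (PrimeSpectrum.basicOpen a : Set (PrimeSpectrum T)),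
      (PrimeSpectrum.basicOpen a).2.preimage continuous_subtype_val⟩
  have hpW : p ∈ W := ⟨hpV, ha⟩
  have hWU : W ≤ U := inf_le_left.trans i.le
  let t : (structurePresheaf T).obj (op W) := ⟨fun q => Localization.mk f ⟨a, q.2.2⟩,
    fun q => ⟨W, q.2, 𝟙 _, f, a, fun q' => ⟨q'.2.2, rfl⟩⟩⟩
  refine IsUnit.of_mul_eq_one ((structurePresheaf T).germ W p hpW t) ?_
  rw [← TopCat.Presheaf.germ_res_apply _ (homOfLE hWU) p hpW]
  refine (map_mul ((structurePresheaf T).germ W p hpW).hom _ t).symm.trans ?_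
  refine Eq.trans ?_ (map_one ((structurePresheaf T).germ W p hpW).hom)
  congr 1
  refine Subtype.ext (funext fun q => ?_)
  obtain ⟨hf, e⟩ := h ⟨q.1, q.2.1⟩
  refine (congr($e * Localization.mk f ⟨a, q.2.2⟩)).trans ?_
  refine (Localization.mk_mul ..).trans (Eq.trans ?_ Localization.mk_one)
  exact Localization.mk_eq_mk_iff.2 (Localization.r_iff_exists.2 ⟨1, by simp [mul_comm]⟩)

theorem isKLocal_stalk (p : Top T) : IsKLocal ((structurePresheaf T).stalk p) := by
  let M := (IsLocalRing.maximalIdeal (Loc T p)).comap (stalkEval T p).hom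
  have hM : IsKIdeal M := by
    rintro a b c ha hb rfl
    exact isKIdeal_maximalIdeal p _ _ _ ha hb (map_add _ _ _).symm
  have hM' : M ≠ ⊤ := Ideal.comap_ne_top _ (IsLocalRing.maximalIdeal.isMaximal _).ne_top
  have key : ∀ I : Ideal ((structurePresheaf T).stalk p), I ≠ ⊤ → I ≤ M := by
    intro I hI s hs
    by_contra h
    exact hI (Ideal.eq_top_of_isUnit_mem _ hs (isUnit_of_stalkEval p s h))
  refine ⟨M, ⟨hM, hM', fun I _ hI h => le_antisymm (key I hI) h⟩, ?_⟩
  intro N hN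
  exact (hN.eq_of_le M hM hM' (key N hN.ne_top)).symm

/-- `Spec_k(T)` for an idempotent semiring `T`, as a locally idempotent semiringed space. -/
def _root_.SpecK (T : Type u) [CommSemiring T] (hT : IsIdempotentSemiring T) :
    LocallyIdempotentSpace.{u} where
  toSheafedSpace := sheafedSpace T
  idempotent U s := by
    refine Subtype.ext (funext fun q => ?_)
    change s.1 q + s.1 q = s.1 q
    induction s.1 q using Localization.induction_on with | _ x
    rw [Localization.add_mk_self, hT]
  isKLocal p := isKLocal_stalk p

end SpecK

/-! ### The two categories -/

/-- A tropical affine scheme is a locally idempotent semiringed space that is isomorphic to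
`Spec_k(T)` for some realizable semiring `T`. -/
def isTropicalAffine : ObjectProperty LocallyIdempotentSpace.{u} := fun X =>
  ∃ (T : Type u) (_ : CommSemiring T) (hT : IsRealizable T),
    Nonempty (X ≅ SpecK T hT.isIdempotentSemiring)

/-- The category of tropical affine schemes. -/
abbrev TropicalAffineScheme : Type (u + 1) := isTropicalAffine.{u}.FullSubcategory

/-- The property of being realizable, for objects of the category of commutative semirings. -/
def isRealizable : ObjectProperty CommSemiRingCat.{u} := fun T => IsRealizable T

/-- The category of realizable semirings, with all semiring morphisms. -/
abbrev RealizableSemiring : Type (u + 1) := isRealizable.{u}.FullSubcategory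

/-- The functor that sends a tropical affine scheme to the semiring of global sections of its
structure sheaf. -/
def TropicalAffineScheme.Γ : TropicalAffineScheme.{u}ᵒᵖ ⥤ CommSemiRingCat.{u} :=
  isTropicalAffine.ι.op ⋙ LocallyIdempotentSpace.Γ

end

/-!
Only one property of realizable semirings is needed: `a + 1 = 1` for all `a`. It makes `T`
idempotent, with greatest element `1` in the natural order `a ≤ b ↔ a + b = b`, and `k`-ideals are
the ideals that are lower sets. Zorn's lemma provides enough prime `k`-ideals
(`exists_prime_isKIdeal`), and this replaces each compactness argument: if each prime `k`-ideal
containing an ideal `I` contains `f`, then some element of `I` is at least some power of `f`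
(`exists_pow_add_eq`).

The core is that `T` is the semiring of global sections of `Spec_k(T)` (`globalSectionsEquiv`).
Injectivity holds because `{c | c * a = c * b}` is an ideal. For surjectivity, note that basic open
sets satisfy `D(d) ∪ D(e) = D(d + e)`; so if the `d` such that a given section is a single
fraction on `D(d)` are closed under addition, they form an ideal, which contains `1` because the
section is locally a fraction. The closure under addition (`IsFractionOn.add`) needs some care.
If `a / f = b / g` at all primes in `D(f * g)`, there are `h` and `N` with
`h * (g * a) = h * (f * b)` and `(f * g) ^ N ≤ h`. One cannot replace `h` by a power of `f * g`
here, since multiplying with a smaller element is not multiplying with a multiple of `h`. Still,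
`(f ^ N * a + g ^ N * b) / (f ^ (N + 1) + g ^ (N + 1))` is a common value on `D(f + g)`, with
`f ^ (2 * N + 1) + h` witnessing the equality with `a / f` (`glue_fractions`).

The rest follows the pattern of affine schemes. A morphism of semirings `φ` induces a morphism of
spectra (`specMap`). Conversely a morphism `f : X ⟶ Spec_k(T)` is determined by the induced map
`T → 𝒪_X(X)` (`globalHom_injective`): locality recovers `f x` as the set of `a` whose image has its
germ at `x` in the maximal `k`-ideal, and sections are locally fractions, with denominators that
become units.
-/

noncomputable section

/-! ### `k`-ideals in idempotent semirings -/

section KIdeal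

variable {T : Type*} [CommSemiring T]

theorem IsIdempotentSemiring.of_add_one (h : ∀ a : T, a + 1 = 1) : IsIdempotentSemiring T := by
  intro a
  simpa [mul_add] using congr(a * $(h 1))

/-- In the natural order `a ≤ b ↔ a + b = b`, a `k`-ideal is a lower set. -/
theorem IsKIdeal.mem_of_add_eq {I : Ideal T} (hI : IsKIdeal I) {a b : T} (hb : b ∈ I)
    (h : a + b = b) : a ∈ I :=
  hI b b a hb hb (by rw [add_comm, h])

theorem IsKIdeal.add_mem_iff (hT : IsIdempotentSemiring T) {I : Ideal T} (hI : IsKIdeal I)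
    {a b : T} : a + b ∈ I ↔ a ∈ I ∧ b ∈ I := by
  refine ⟨fun h => ⟨hI.mem_of_add_eq h ?_, hI.mem_of_add_eq h ?_⟩, fun h => I.add_mem h.1 h.2⟩
  · rw [← add_assoc, hT]
  · rw [add_left_comm, hT]

/-- The `k`-ideal generated by an ideal of an idempotent semiring: its closure under passing to
smaller elements in the natural order. -/
def Ideal.kClosure (I : Ideal T) : Ideal T where
  carrier := {a | ∃ b ∈ I, a + b = b}
  zero_mem' := ⟨0, I.zero_mem, zero_add 0⟩
  add_mem' := by
    rintro a a' ⟨b, hb, h⟩ ⟨b', hb', h'⟩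
    exact ⟨b + b', I.add_mem hb hb', by rw [add_add_add_comm, h, h']⟩
  smul_mem' := by
    rintro c a ⟨b, hb, h⟩
    exact ⟨c * b, I.mul_mem_left c hb, by rw [smul_eq_mul, ← mul_add, h]⟩

theorem Ideal.le_kClosure (hT : IsIdempotentSemiring T) (I : Ideal T) : I ≤ I.kClosure :=
  fun a ha => ⟨a, ha, hT a⟩

theorem Ideal.isKIdeal_kClosure (hT : IsIdempotentSemiring T) (I : Ideal T) :
    IsKIdeal I.kClosure := by
  rintro a c b - ⟨d, hd, h⟩ rfl
  exact ⟨d, hd, by rw [← h, ← add_assoc, add_left_comm b a b, hT]⟩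

/-- A `k`-ideal that contains no power of `f` is contained in a prime `k`-ideal that does not
contain `f`. -/
theorem exists_prime_isKIdeal (hT : IsIdempotentSemiring T) (J : Ideal T) (hJ : IsKIdeal J)
    (f : T) (hf : ∀ n : ℕ, f ^ n ∉ J) :
    ∃ P : Ideal T, P.IsPrime ∧ IsKIdeal P ∧ J ≤ P ∧ f ∉ P := by
  obtain ⟨P, hJP, hP⟩ := zorn_le_nonempty₀ {I : Ideal T | IsKIdeal I ∧ ∀ n : ℕ, f ^ n ∉ I}
    (fun c hc hchain I hI => by
      have mem {x : T} : x ∈ sSup c ↔ ∃ K ∈ c, x ∈ K :=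
        Submodule.mem_sSup_of_directed ⟨I, hI⟩ hchain.directedOn
      refine ⟨sSup c, ⟨fun x y z hx hy h => ?_, fun n hn => ?_⟩, fun K hK => le_sSup hK⟩
      · obtain ⟨K, hK, hxK⟩ := mem.1 hx
        obtain ⟨L, hL, hyL⟩ := mem.1 hy
        rcases hchain.total hK hL with hle | hle
        · exact mem.2 ⟨L, hL, (hc hL).1 x y z (hle hxK) hyL h⟩
        · exact mem.2 ⟨K, hK, (hc hK).1 x y z hxK (hle hyL) h⟩
      · obtain ⟨K, hK, h⟩ := mem.1 hn
        exact (hc hK).2 n h)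
    J ⟨hJ, hf⟩
  have key {a : T} (ha : a ∉ P) : ∃ n : ℕ, ∃ b ∈ P ⊔ Ideal.span {a}, f ^ n + b = b := by
    by_contra! h
    refine ha (hP.2 (y := (P ⊔ Ideal.span {a}).kClosure)
      ⟨Ideal.isKIdeal_kClosure hT _, fun n hn => ?_⟩
      (le_sup_left.trans (Ideal.le_kClosure hT _)) ?_)
    · obtain ⟨b, hb, e⟩ := hn
      exact h n b hb e
    · exact Ideal.le_kClosure hT _
        (le_sup_right (a := P) (Ideal.subset_span (Set.mem_singleton a)))
  refine ⟨P, ⟨fun h => hP.1.2 0 (h ▸ Submodule.mem_top), fun {a b} hab => ?_⟩, hP.1.1, hJP,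
    fun h => hP.1.2 1 (by simpa using h)⟩
  by_contra! h
  obtain ⟨n, x, hx, ex⟩ := key h.1
  obtain ⟨m, y, hy, ey⟩ := key h.2
  have hxy : x * y ∈ P := by
    obtain ⟨p, hp, _, ht, rfl⟩ := Submodule.mem_sup.1 hx
    obtain ⟨q, hq, _, hs, rfl⟩ := Submodule.mem_sup.1 hy
    obtain ⟨t, rfl⟩ := Ideal.mem_span_singleton'.1 ht
    obtain ⟨s, rfl⟩ := Ideal.mem_span_singleton'.1 hs
    have : (p + t * a) * (q + s * b) = (q + s * b) * p + t * a * q + t * s * (a * b) := by ring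
    rw [this]
    exact P.add_mem (P.add_mem (P.mul_mem_left _ hp) (P.mul_mem_left _ hq)) (P.mul_mem_left _ hab)
  refine hP.1.2 (n + m) (hP.1.1.mem_of_add_eq hxy ?_)
  rw [← ex, ← ey, pow_add, add_mul, ← add_assoc, mul_add (f ^ n), ← add_assoc, hT]

/-- If an ideal meets the complement of each prime `k`-ideal that does not contain `f`, then
some power of `f` is at most some element of the ideal. -/
theorem exists_pow_add_eq (hT : IsIdempotentSemiring T) (I : Ideal T) (f : T)
    (h : ∀ q : KSpec T, f ∉ q.1.asIdeal → ∃ c ∈ I, c ∉ q.1.asIdeal) :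
    ∃ (n : ℕ), ∃ c ∈ I, f ^ n + c = c := by
  by_contra! hI
  obtain ⟨P, hP, hPk, hle, hf⟩ := exists_prime_isKIdeal hT I.kClosure (Ideal.isKIdeal_kClosure hT I)
    f (fun n ⟨c, hc, e⟩ => hI n c hc e)
  obtain ⟨c, hc, hcP⟩ := h ⟨⟨P, hP⟩, hPk⟩ hf
  exact hcP (hle (Ideal.le_kClosure hT I hc))

/-- If `a + 1 = 1` for all `a`, an ideal that is contained in no prime `k`-ideal contains `1`. -/
theorem one_mem_of_forall_kSpec (h1 : ∀ a : T, a + 1 = 1) (I : Ideal T)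
    (h : ∀ q : KSpec T, ∃ c ∈ I, c ∉ q.1.asIdeal) : (1 : T) ∈ I := by
  obtain ⟨n, c, hc, e⟩ := exists_pow_add_eq (.of_add_one h1) I 1 fun q _ => h q
  rw [one_pow, add_comm, h1] at e
  exact e ▸ hc

/-- The ideal of all `c` with `c * x = c * y`. -/
def eqIdeal (x y : T) : Ideal T where
  carrier := {c | c * x = c * y}
  zero_mem' := by simp
  add_mem' {c d} hc hd := by
    change (c + d) * x = (c + d) * y
    rw [add_mul, add_mul, hc, hd]
  smul_mem' c d hd := by
    change c * d * x = c * d * y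
    rw [mul_assoc, hd, mul_assoc]

theorem mem_eqIdeal {x y c : T} : c ∈ eqIdeal x y ↔ c * x = c * y :=
  Iff.rfl

end KIdeal

/-! ### Gluing two fractions -/

section Glue

/-- Half of the computation that glues two fractions `a / f` and `b / g`. The common value is
`(f ^ N * a + g ^ N * b) / (f ^ (N + 1) + g ^ (N + 1))`; the equality of this fraction with
`a / f` holds only after multiplication with `f ^ (2 * N + 1) + h`. The second summand is needed
since `(f * g) ^ N ≤ h` and `h * x = h * y` do not imply `(f * g) ^ N * x = (f * g) ^ N * y`. -/
theorem glue_fractions_of_le {T : Type*} [IdemCommSemiring T] (h1 : ∀ a : T, a ≤ 1)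
    {a b f g h : T} {N : ℕ} (hab : h * (g * a) = h * (f * b)) (hN : (f * g) ^ N ≤ h) :
    (f ^ (2 * N + 1) + h) * ((f ^ (N + 1) + g ^ (N + 1)) * a) =
      (f ^ (2 * N + 1) + h) * (f * (f ^ N * a + g ^ N * b)) := by
  have hh : h * ((f ^ (N + 1) + g ^ (N + 1)) * a) = h * (f * (f ^ N * a + g ^ N * b)) := by
    calc _ = h * (f ^ (N + 1) * a) + g ^ N * (h * (g * a)) := by ring
      _ = _ := by rw [hab]; ring
  rw [add_mul _ h, add_mul _ h, ← hh]
  apply le_antisymm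
  · refine add_le ?_ le_add_self
    calc f ^ (2 * N + 1) * ((f ^ (N + 1) + g ^ (N + 1)) * a)
        = f ^ (2 * N + 1) * (f * (f ^ N * a)) + (f * g) ^ N * (f ^ (N + 1) * a) * g := by ring
      _ ≤ f ^ (2 * N + 1) * (f * (f ^ N * a + g ^ N * b)) + h * (f ^ (N + 1) * a) * 1 := by
        gcongr
        · exact le_self_add
        · exact h1 g
      _ ≤ _ := by
        rw [mul_one]
        gcongr
        exact le_self_add
  · refine add_le ?_ le_add_self
    calc f ^ (2 * N + 1) * (f * (f ^ N * a + g ^ N * b))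
        = f ^ (2 * N + 1) * (f ^ (N + 1) * a) + (f * g) ^ N * (f * b) * f ^ (N + 1) := by ring
      _ ≤ f ^ (2 * N + 1) * (f ^ (N + 1) * a) + h * (f * b) * f ^ (N + 1) := by gcongr
      _ = f ^ (2 * N + 1) * (f ^ (N + 1) * a) + g * (h * (f ^ (N + 1) * a)) := by
        rw [← hab]; ring
      _ ≤ f ^ (2 * N + 1) * ((f ^ (N + 1) + g ^ (N + 1)) * a) + 1 * (h * (f ^ (N + 1) * a)) := by
        gcongr
        · exact le_self_add
        · exact h1 g
      _ ≤ _ := by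
        rw [one_mul]
        gcongr
        exact le_self_add

theorem glue_fractions {T : Type*} [CommSemiring T] (h1 : ∀ a : T, a + 1 = 1)
    {a b f g h : T} {N : ℕ} (hab : h * (g * a) = h * (f * b)) (hN : (f * g) ^ N + h = h) :
    (f ^ (2 * N + 1) + h) * ((f ^ (N + 1) + g ^ (N + 1)) * a) =
      (f ^ (2 * N + 1) + h) * (f * (f ^ N * a + g ^ N * b)) :=
  letI i : IdemSemiring T := IdemSemiring.ofSemiring (IsIdempotentSemiring.of_add_one h1)
  letI : IdemCommSemiring T := { i, ‹CommSemiring T› with }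
  glue_fractions_of_le (fun a => h1 a) hab hN

end Glue

/-! ### Global sections of the structure sheaf -/

namespace SpecK

section Sections

variable {T : Type u} [CommSemiring T]

theorem mk_eq_mk_iff {p : Top T} {a b f g : T} (hf : f ∉ p.1.asIdeal) (hg : g ∉ p.1.asIdeal) :
    (Localization.mk a ⟨f, hf⟩ : Loc T p) = Localization.mk b ⟨g, hg⟩ ↔
      ∃ c ∉ p.1.asIdeal, c * (g * a) = c * (f * b) := by
  rw [Localization.mk_eq_mk_iff, Localization.r_iff_exists]
  exact ⟨fun ⟨c, h⟩ => ⟨c, c.2, h⟩, fun ⟨c, hc, h⟩ => ⟨⟨c, hc⟩, h⟩⟩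

variable (T) in
/-- The set of prime `k`-ideals that do not contain `f`. -/
def basicOpen (f : T) : Opens (Top T) :=
  ⟨{p | f ∉ p.1.asIdeal}, (PrimeSpectrum.basicOpen f).2.preimage continuous_subtype_val⟩

theorem exists_basicOpen_le {U : Opens (Top T)} {p : Top T} (hp : p ∈ U) :
    ∃ f : T, p ∈ basicOpen T f ∧ basicOpen T f ≤ U := by
  obtain ⟨V, hV, hVU⟩ := U.2
  have hp' : p.1 ∈ V := by
    have : p ∈ Subtype.val ⁻¹' V := hVU ▸ hp
    exact this
  obtain ⟨_, ⟨f, rfl⟩, hf, hfV⟩ :=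
    PrimeSpectrum.isTopologicalBasis_basic_opens.exists_subset_of_mem_open hp' hV
  refine ⟨f, hf, fun q hq => ?_⟩
  have : q ∈ Subtype.val ⁻¹' V := hfV hq
  rw [hVU] at this
  exact this

variable (T) in
/-- The canonical map from `T` to the sections of the structure sheaf over `U`. -/
def toSections (U : Opens (Top T)) : T →+* sections T U where
  toFun a := ⟨fun p => algebraMap T (Loc T p.1) a, fun p => ⟨U, p.2, 𝟙 _, a, 1, fun q =>
    ⟨q.1.1.asIdeal.ne_top_iff_one.1 q.1.1.isPrime.ne_top,
      (Localization.mk_one_eq_algebraMap a).symm⟩⟩⟩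
  map_zero' := Subtype.ext (funext fun p => map_zero (algebraMap T (Loc T p.1)))
  map_one' := Subtype.ext (funext fun p => map_one (algebraMap T (Loc T p.1)))
  map_add' a b := Subtype.ext (funext fun p => map_add (algebraMap T (Loc T p.1)) a b)
  map_mul' a b := Subtype.ext (funext fun p => map_mul (algebraMap T (Loc T p.1)) a b)

theorem toSections_injective (h1 : ∀ a : T, a + 1 = 1) :
    Function.Injective (toSections T ⊤) := by
  intro a b hab
  have h : (1 : T) ∈ eqIdeal a b := by
    refine one_mem_of_forall_kSpec h1 _ fun q => ?_
    have e : algebraMap T (Loc T q) a = algebraMap T (Loc T q) b :=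
      congrFun (congrArg Subtype.val hab) ⟨q, trivial⟩
    obtain ⟨c, hc⟩ := (IsLocalization.eq_iff_exists q.1.asIdeal.primeCompl _).1 e
    exact ⟨c, hc, c.2⟩
  simpa [mem_eqIdeal] using h

/-- `s` is given by a single fraction on the basic open set of `d`. -/
def IsFractionOn (s : ∀ p : Top T, Loc T p) (d : T) : Prop :=
  ∃ a f : T, ∀ q : Top T, d ∉ q.1.asIdeal →
    ∃ hf : f ∉ q.1.asIdeal, s q = Localization.mk a ⟨f, hf⟩

/-- The basic open set of `d + e` is the union of those of `d` and `e`, since primes are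
`k`-ideals, and fractions on the latter two that agree on the overlap glue to a single fraction. -/
theorem IsFractionOn.add (h1 : ∀ a : T, a + 1 = 1) {s : ∀ p : Top T, Loc T p} {d e : T}
    (hd : IsFractionOn s d) (he : IsFractionOn s e) : IsFractionOn s (d + e) := by
  have hT := IsIdempotentSemiring.of_add_one h1
  -- Expanding a fraction by `d` gives a denominator `f` with the same basic open set as `d`.
  have key {d : T} (hd : IsFractionOn s d) : ∃ a f : T,
      (∀ q : Top T, f ∉ q.1.asIdeal ↔ d ∉ q.1.asIdeal) ∧ ∀ (q : Top T) (hf : f ∉ q.1.asIdeal),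
        s q = Localization.mk a ⟨f, hf⟩ := by
    obtain ⟨a, f, h⟩ := hd
    have hq (q : Top T) : d * f ∉ q.1.asIdeal ↔ d ∉ q.1.asIdeal := by
      refine ⟨fun hdf hd => hdf (q.1.asIdeal.mul_mem_right _ hd), fun hd hdf => ?_⟩
      exact (q.1.isPrime.mem_or_mem hdf).elim hd (h q hd).1
    refine ⟨d * a, d * f, hq, fun q hdf => ?_⟩
    obtain ⟨hf, e⟩ := h q ((hq q).1 hdf)
    rw [e, mk_eq_mk_iff]
    exact ⟨1, q.1.asIdeal.ne_top_iff_one.1 q.1.isPrime.ne_top, by ring⟩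
  obtain ⟨a, f, hf, hs⟩ := key hd
  obtain ⟨b, g, hg, ht⟩ := key he
  obtain ⟨N, h, hab, hN⟩ := exists_pow_add_eq hT (eqIdeal (g * a) (f * b)) (f * g) (by
    intro q hq
    have hfq : f ∉ q.1.asIdeal := fun h => hq (q.1.asIdeal.mul_mem_right _ h)
    have hgq : g ∉ q.1.asIdeal := fun h => hq (q.1.asIdeal.mul_mem_left _ h)
    obtain ⟨c, hc, e⟩ := (mk_eq_mk_iff hfq hgq).1 ((hs q hfq).symm.trans (ht q hgq))
    exact ⟨c, e, hc⟩)
  rw [mem_eqIdeal] at hab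
  have pow_notMem {q : Top T} {f : T} (hf : f ∉ q.1.asIdeal) (n : ℕ) : f ^ n ∉ q.1.asIdeal :=
    fun h => hf (q.1.isPrime.mem_of_pow_mem n h)
  refine ⟨f ^ N * a + g ^ N * b, f ^ (N + 1) + g ^ (N + 1), fun q hq => ?_⟩
  rw [q.2.add_mem_iff hT, not_and_or, ← hf, ← hg] at hq
  rcases hq with hq | hq
  · have hfg : f ^ (N + 1) + g ^ (N + 1) ∉ q.1.asIdeal := fun h =>
      pow_notMem hq (N + 1) ((q.2.add_mem_iff hT).1 h).1
    refine ⟨hfg, (hs q hq).trans ((mk_eq_mk_iff hq hfg).2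
      ⟨f ^ (2 * N + 1) + h, fun h' => ?_, glue_fractions h1 hab hN⟩)⟩
    exact pow_notMem hq _ ((q.2.add_mem_iff hT).1 h').1
  · have hfg : f ^ (N + 1) + g ^ (N + 1) ∉ q.1.asIdeal := fun h =>
      pow_notMem hq (N + 1) ((q.2.add_mem_iff hT).1 h).2
    refine ⟨hfg, (ht q hq).trans ((mk_eq_mk_iff hq hfg).2
      ⟨g ^ (2 * N + 1) + h, fun h' => ?_, ?_⟩)⟩
    · exact pow_notMem hq _ ((q.2.add_mem_iff hT).1 h').1
    · rw [add_comm (f ^ (N + 1)), add_comm (f ^ N * a)]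
      exact glue_fractions h1 hab.symm (by rwa [mul_comm g f])

theorem toSections_surjective (h1 : ∀ a : T, a + 1 = 1) :
    Function.Surjective (toSections T ⊤) := by
  intro s
  let s' : ∀ p : Top T, Loc T p := fun p => s.1 ⟨p, trivial⟩
  let I : Ideal T :=
    { carrier := {d | IsFractionOn s' d}
      zero_mem' := ⟨0, 1, fun q hq => (hq q.1.asIdeal.zero_mem).elim⟩
      add_mem' := IsFractionOn.add h1
      smul_mem' := fun c d ⟨a, f, h⟩ =>
        ⟨a, f, fun q hq => h q fun hd => hq (q.1.asIdeal.mul_mem_left c hd)⟩ }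
  have hI : (1 : T) ∈ I := by
    refine one_mem_of_forall_kSpec h1 I fun q => ?_
    obtain ⟨V, hq, i, a, f, h⟩ := s.2 ⟨q, trivial⟩
    obtain ⟨d, hd, hdV⟩ := exists_basicOpen_le hq
    exact ⟨d, ⟨a, f, fun p hp => h ⟨p, hdV hp⟩⟩, hd⟩
  obtain ⟨a, f, h⟩ := hI
  have h' (q : Top T) := h q (q.1.asIdeal.ne_top_iff_one.1 q.1.isPrime.ne_top)
  -- The denominator `f` lies in no prime `k`-ideal, hence is a unit.
  obtain ⟨g, hg⟩ := Ideal.mem_span_singleton'.1 (one_mem_of_forall_kSpec h1 (Ideal.span {f})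
    fun q => ⟨f, Ideal.subset_span (Set.mem_singleton f), (h' q).1⟩)
  refine ⟨g * a, Subtype.ext (funext fun q => ?_)⟩
  obtain ⟨hf, e⟩ := h' q.1
  refine Eq.trans ?_ e.symm
  refine (Localization.mk_one_eq_algebraMap (g * a)).symm.trans ((mk_eq_mk_iff
    (q.1.1.asIdeal.ne_top_iff_one.1 q.1.1.isPrime.ne_top) hf).2
    ⟨1, q.1.1.asIdeal.ne_top_iff_one.1 q.1.1.isPrime.ne_top, ?_⟩)
  calc 1 * (f * (g * a)) = g * f * a := by ring
    _ = _ := by rw [hg, one_mul (1 * a)]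

variable (T) in
/-- A semiring with greatest element `1` is the semiring of global sections of its spectrum. -/
def globalSectionsEquiv (h1 : ∀ a : T, a + 1 = 1) : T ≃+* sections T ⊤ :=
  RingEquiv.ofBijective (toSections T ⊤) ⟨toSections_injective h1, toSections_surjective h1⟩

end Sections

end SpecK

/-! ### The morphism of spectra induced by a morphism of semirings -/

namespace SpecK

section SpecMap

variable {T₁ T₂ : Type u} [CommSemiring T₁] [CommSemiring T₂]

/-- A maximal `k`-ideal of a stalk consists of the germs whose value is not a unit. -/
theorem mem_isMaximalKIdeal_stalk_iff {p : Top T₁}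
    {M : Ideal ((structurePresheaf T₁).stalk p)} (hM : IsMaximalKIdeal M)
    (s : (structurePresheaf T₁).stalk p) :
    s ∈ M ↔ (stalkEval T₁ p).hom s ∈ IsLocalRing.maximalIdeal (Loc T₁ p) := by
  have hle : M ≤ (IsLocalRing.maximalIdeal (Loc T₁ p)).comap (stalkEval T₁ p).hom := by
    intro s hs
    by_contra h
    exact hM.ne_top (Ideal.eq_top_of_isUnit_mem _ hs (isUnit_of_stalkEval p s h))
  have := hM.eq_of_le _ (by
    rintro a b c ha hb rfl
    exact isKIdeal_maximalIdeal p _ _ _ ha hb (map_add _ _ _).symm)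
    (Ideal.comap_ne_top _ (IsLocalRing.maximalIdeal.isMaximal _).ne_top) hle
  rw [← this, Ideal.mem_comap]

/-- The map of spectra `q ↦ φ⁻¹(q)`. -/
def comap (φ : T₁ →+* T₂) : Top T₂ ⟶ Top T₁ :=
  TopCat.ofHom
    { toFun q := ⟨PrimeSpectrum.comap φ q.1, fun a b c ha hb h =>
        q.2 (φ a) (φ b) (φ c) ha hb (by rw [← map_add, h])⟩
      continuous_toFun :=
        ((PrimeSpectrum.continuous_comap φ).comp continuous_subtype_val).subtype_mk _ }

/-- The map `T₁_{φ⁻¹(q)} → T₂_q` induced by `φ`. -/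
def locMap (φ : T₁ →+* T₂) (q : Top T₂) : Loc T₁ ((comap φ).hom q) →+* Loc T₂ q :=
  Localization.localRingHom _ q.1.asIdeal φ rfl

theorem locMap_mk (φ : T₁ →+* T₂) (q : Top T₂) (a f : T₁) (hf) (hf') :
    locMap φ q (Localization.mk a ⟨f, hf⟩) = Localization.mk (φ a) ⟨φ f, hf'⟩ :=
  Localization.localRingHom_mk ..

theorem locMap_mem_maximalIdeal (φ : T₁ →+* T₂) (q : Top T₂) {x : Loc T₁ ((comap φ).hom q)}
    (hx : x ∈ IsLocalRing.maximalIdeal (Loc T₁ ((comap φ).hom q))) :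
    locMap φ q x ∈ IsLocalRing.maximalIdeal (Loc T₂ q) := by
  have : IsLocalHom (locMap φ q) := Localization.isLocalHom_localRingHom ..
  exact fun h => hx (isUnit_of_map_unit _ x h)

/-- Pulling back sections of the structure sheaf along `comap φ`. -/
def sectionsMap (φ : T₁ →+* T₂) (U : Opens (Top T₁)) :
    sections T₁ U →+* sections T₂ ((Opens.map (comap φ)).obj U) where
  toFun s := ⟨fun q => locMap φ q.1 (s.1 ⟨(comap φ).hom q.1, q.2⟩), fun q => by
    obtain ⟨V, hV, i, a, f, h⟩ := s.2 ⟨(comap φ).hom q.1, q.2⟩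
    refine ⟨(Opens.map (comap φ)).obj V, hV, (Opens.map (comap φ)).map i, φ a, φ f, fun q' => ?_⟩
    obtain ⟨hf, e⟩ := h ⟨(comap φ).hom q'.1, q'.2⟩
    exact ⟨hf, (congrArg (locMap φ q'.1) e).trans (locMap_mk ..)⟩⟩
  map_zero' := Subtype.ext (funext fun q => map_zero (locMap φ q.1))
  map_one' := Subtype.ext (funext fun q => map_one (locMap φ q.1))
  map_add' _ _ := Subtype.ext (funext fun q => map_add (locMap φ q.1) _ _)
  map_mul' _ _ := Subtype.ext (funext fun q => map_mul (locMap φ q.1) _ _)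

theorem sectionsMap_toSections (φ : T₁ →+* T₂) (a : T₁) :
    sectionsMap φ ⊤ (toSections T₁ ⊤ a) = toSections T₂ ⊤ (φ a) :=
  Subtype.ext (funext fun _ => Localization.localRingHom_to_map ..)

/-- The morphism of semiringed spaces induced by `φ`. -/
def presheafedSpaceMap (φ : T₁ →+* T₂) :
    (sheafedSpace T₂).toPresheafedSpace ⟶ (sheafedSpace T₁).toPresheafedSpace where
  base := comap φ
  c :=
    { app U := CommSemiRingCat.ofHom (sectionsMap φ U.unop)
      naturality _ _ _ := rfl }

theorem stalkEval_stalkMap (φ : T₁ →+* T₂) (q : Top T₂)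
    (s : (structurePresheaf T₁).stalk ((comap φ).hom q)) :
    (stalkEval T₂ q).hom (((presheafedSpaceMap φ).stalkMap q).hom s) =
      locMap φ q ((stalkEval T₁ ((comap φ).hom q)).hom s) := by
  obtain ⟨U, hU, s, rfl⟩ := TopCat.Presheaf.exists_germ_eq _ s
  refine (congrArg (stalkEval T₂ q).hom
    (PresheafedSpace.stalkMap_germ_apply (presheafedSpaceMap φ) U q hU s)).trans ?_
  refine (stalkEval_germ q ((Opens.map (comap φ)).obj U) hU _).trans ?_
  exact (congrArg (locMap φ q) (stalkEval_germ ((comap φ).hom q) U hU s)).symm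

/-- The morphism of locally idempotent semiringed spaces induced by `φ`. -/
def specMap (h₁ : IsIdempotentSemiring T₁) (h₂ : IsIdempotentSemiring T₂) (φ : T₁ →+* T₂) :
    SpecK T₂ h₂ ⟶ SpecK T₁ h₁ where
  toHom := presheafedSpaceMap φ
  prop q M M' hM hM' a ha := by
    refine (mem_isMaximalKIdeal_stalk_iff hM' _).2 ?_
    have e := stalkEval_stalkMap φ q a
    refine e ▸ ?_
    exact locMap_mem_maximalIdeal φ q ((mem_isMaximalKIdeal_stalk_iff hM _).1 ha)

end SpecMap

/-! ### Morphisms to a spectrum are determined by their effect on global sections -/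

section Faithful

variable {T : Type u} [CommSemiring T] {hT : IsIdempotentSemiring T}
  {X : LocallyIdempotentSpace.{u}}

/-- The map `T → 𝒪_X(X)` given by a morphism `X ⟶ Spec_k(T)`. -/
def globalHom (f : X ⟶ SpecK T hT) : T →+* X.presheaf.obj (op ⊤) :=
  (f.c.app (op ⊤)).hom.comp (toSections T ⊤)

/-- The point `f x` is recovered from `globalHom f` since the map on stalks is local. -/
theorem mem_base_iff (f : X ⟶ SpecK T hT) (x : X.carrier) {M : Ideal (X.presheaf.stalk x)}
    (hM : IsMaximalKIdeal M) (a : T) :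
    a ∈ (show Top T from f.base x).1.asIdeal ↔
      (X.presheaf.germ ⊤ x trivial).hom (globalHom f a) ∈ M := by
  let p : Top T := f.base x
  change a ∈ p.1.asIdeal ↔ _
  obtain ⟨N, hN, -⟩ := isKLocal_stalk p
  let t : (structurePresheaf T).stalk p :=
    ((structurePresheaf T).germ ⊤ p trivial).hom (toSections T ⊤ a)
  have e : (f.stalkMap x).hom t = (X.presheaf.germ ⊤ x trivial).hom (globalHom f a) :=
    PresheafedSpace.stalkMap_germ_apply f.toHom ⊤ x trivial (toSections T ⊤ a)
  have ht : (stalkEval T p).hom t = Localization.mk a 1 :=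
    (stalkEval_germ p ⊤ trivial _).trans (Localization.mk_one_eq_algebraMap a).symm
  rw [← e]
  constructor
  · intro ha
    refine f.prop x N M hN hM t ((mem_isMaximalKIdeal_stalk_iff hN t).2 ?_)
    exact ht ▸ mk_mem_maximalIdeal.2 ha
  · intro h
    by_contra ha
    refine hM.ne_top (Ideal.eq_top_of_isUnit_mem _ h (IsUnit.map (f.stalkMap x).hom ?_))
    exact isUnit_of_stalkEval p t (ht ▸ fun h => ha (mk_mem_maximalIdeal.1 h))

theorem base_eq_of_globalHom_eq {f g : X ⟶ SpecK T hT} (h : globalHom f = globalHom g) :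
    f.base = g.base := by
  ext x
  obtain ⟨M, hM, -⟩ := X.isKLocal x
  refine Subtype.ext (PrimeSpectrum.ext (Ideal.ext fun a => ?_))
  exact (mem_base_iff f x hM a).trans (h ▸ (mem_base_iff g x hM a).symm)

theorem ringHom_eq_of_fraction {S S' : Type*} [CommSemiring S] [CommSemiring S'] (c d : S →+* S')
    {s a f i : S} (h : s * f = a) (hi : f * i = 1) (ha : c a = d a) (hf : c f = d f) :
    c s = d s := by
  have hs : a * i = s := by rw [← h, mul_assoc, hi, mul_one]
  have hci : c f * c i = 1 := by rw [← map_mul, hi, map_one]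
  have hdi : c f * d i = 1 := by rw [hf, ← map_mul, hi, map_one]
  have hcd : c i = d i := by
    rw [← mul_one (c i), ← hdi, ← mul_assoc, mul_comm (c i), hci, one_mul]
  rw [← hs, map_mul, map_mul, ha, hcd]

/-- A map of sheaves `𝒪 → f_* 𝒪_X` over `Spec_k(T)` is determined by the images of the elements
of `T`, since locally each section is a fraction and denominators are mapped to units. -/
theorem c_eq_of_toSections {X : SheafedSpace CommSemiRingCat.{u}} {β : X.carrier ⟶ Top T}
    {c d : structurePresheaf T ⟶ (TopCat.Presheaf.pushforward _ β).obj X.presheaf}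
    (h : ∀ a : T, (c.app (op ⊤)).hom (toSections T ⊤ a) = (d.app (op ⊤)).hom (toSections T ⊤ a)) :
    c = d := by
  have hV (V : Opens (Top T)) (a : T) :
      (c.app (op V)).hom (toSections T V a) = (d.app (op V)).hom (toSections T V a) := by
    have e (c : structurePresheaf T ⟶ (TopCat.Presheaf.pushforward _ β).obj X.presheaf) :
        (c.app (op V)).hom (toSections T V a) =
          (((TopCat.Presheaf.pushforward _ β).obj X.presheaf).map (homOfLE le_top : V ⟶ ⊤).op).hom
            ((c.app (op ⊤)).hom (toSections T ⊤ a)) :=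
      congr($(c.naturality (homOfLE le_top : V ⟶ ⊤).op).hom (toSections T ⊤ a))
    rw [e, e, h]
  have hfrac (V : Opens (Top T)) (s : sections T V) (a f : T)
      (hs : ∀ q : V, ∃ hf : f ∉ q.1.1.asIdeal, s.1 q = Localization.mk a ⟨f, hf⟩) :
      (c.app (op V)).hom s = (d.app (op V)).hom s := by
    have h1 : s * toSections T V f = toSections T V a := by
      refine Subtype.ext (funext fun q => ?_)
      obtain ⟨hf, e⟩ := hs q
      refine (congrArg (· * algebraMap T (Loc T q.1) f) e).trans ?_
      rw [Localization.mk_eq_mk']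
      exact IsLocalization.mk'_spec (Loc T q.1) a ⟨f, hf⟩
    let i : sections T V := ⟨fun q => Localization.mk 1 ⟨f, (hs q).1⟩, fun q =>
      ⟨V, q.2, 𝟙 _, 1, f, fun q' => ⟨(hs q').1, rfl⟩⟩⟩
    have h2 : toSections T V f * i = 1 := by
      refine Subtype.ext (funext fun q => ?_)
      change algebraMap T (Loc T q.1) f * Localization.mk 1 ⟨f, (hs q).1⟩ = 1
      rw [Localization.mk_eq_mk', mul_comm, IsLocalization.mk'_spec, map_one]
    exact ringHom_eq_of_fraction (S := sections T V) (c.app (op V)).hom (d.app (op V)).hom h1 h2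
      (hV V a) (hV V f)
  refine NatTrans.ext (funext fun ⟨U⟩ => ?_)
  ext s
  choose V hVp i a f hs using (show sections T U from s).2
  refine TopCat.Sheaf.eq_of_locally_eq' ⟨X.presheaf, X.IsSheaf⟩
    (fun p : U => (Opens.map β).obj (V p)) ((Opens.map β).obj U)
    (fun p => (Opens.map β).map (i p)) ?_ _ _ ?_
  · intro x hx
    exact Opens.mem_iSup.2 ⟨⟨β x, hx⟩, hVp ⟨β x, hx⟩⟩
  · intro p
    have e (c : structurePresheaf T ⟶ (TopCat.Presheaf.pushforward _ β).obj X.presheaf) :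
        (X.presheaf.map ((Opens.map β).map (i p)).op).hom ((c.app (op U)).hom s) =
          (c.app (op (V p))).hom ((structurePresheaf T).map (i p).op s) :=
      congr($(c.naturality (i p).op).hom s).symm
    exact (e c).trans ((hfrac (V p) _ (a p) (f p) (hs p)).trans (e d).symm)

theorem globalHom_injective :
    Function.Injective (globalHom : (X ⟶ SpecK T hT) → (T →+* X.presheaf.obj (op ⊤))) := by
  intro f g h
  have hb := base_eq_of_globalHom_eq h
  obtain ⟨⟨fb, fc⟩, hf⟩ := f
  obtain ⟨⟨gb, gc⟩, hg⟩ := g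
  obtain rfl : fb = gb := hb
  obtain rfl : fc = gc := c_eq_of_toSections (X := X.toSheafedSpace) fun a => congr($h a)
  rfl

end Faithful

end SpecK

/-! ### The equivalence of categories -/

theorem IsRealizable.add_one {T : Type u} [CommSemiring T] (h : IsRealizable T) (a : T) :
    a + 1 = 1 := by
  obtain ⟨R, _, ⟨e⟩⟩ := h
  apply e.injective
  rw [map_add, map_one]
  refine Subtype.ext ?_
  change (e a : Ideal R) ⊔ 1 = 1
  rw [Ideal.one_eq_top, sup_top_eq]

theorem IsRealizable.of_ringEquiv {T S : Type u} [CommSemiring T] [CommSemiring S]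
    (h : IsRealizable T) (e : S ≃+* T) : IsRealizable S := by
  obtain ⟨R, i, ⟨e'⟩⟩ := h
  exact ⟨R, i, ⟨e.trans e'⟩⟩

namespace SpecK

variable {T₁ T₂ : Type u} [CommSemiring T₁] [CommSemiring T₂]

variable (T₁) in
/-- `globalSectionsEquiv` as an isomorphism in the category of semirings. -/
def ΓIso (h : IsRealizable T₁) :
    CommSemiRingCat.of T₁ ≅
      LocallyIdempotentSpace.Γ.obj (op (SpecK T₁ h.isIdempotentSemiring)) :=
  (globalSectionsEquiv T₁ h.add_one).toCommSemiRingCatIso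

theorem bijective_Γ_map (h₁ : IsRealizable T₁) (h₂ : IsRealizable T₂) :
    Function.Bijective fun f : SpecK T₂ h₂.isIdempotentSemiring ⟶ SpecK T₁ h₁.isIdempotentSemiring =>
      LocallyIdempotentSpace.Γ.map f.op := by
  refine ⟨fun f g h => globalHom_injective ?_, fun α => ?_⟩
  · exact congr(($h).hom.comp (toSections T₁ ⊤))
  · refine ⟨specMap _ _ ((globalSectionsEquiv T₂ h₂.add_one).symm.toRingHom.comp
      ((show sections T₁ ⊤ →+* sections T₂ ⊤ from α.hom).comp (toSections T₁ ⊤))), ?_⟩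
    ext s
    obtain ⟨a, rfl⟩ := toSections_surjective h₁.add_one s
    refine (sectionsMap_toSections _ a).trans ?_
    exact (globalSectionsEquiv T₂ h₂.add_one).apply_symm_apply _

/-- Morphisms of spectra are the same as morphisms of semirings in the opposite direction. -/
def homEquiv (h₁ : IsRealizable T₁) (h₂ : IsRealizable T₂) :
    (T₁ →+* T₂) ≃ (SpecK T₂ h₂.isIdempotentSemiring ⟶ SpecK T₁ h₁.isIdempotentSemiring) :=
  (ConcreteCategory.homEquiv (X := CommSemiRingCat.of T₁) (Y := CommSemiRingCat.of T₂)).symm.trans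
    (((ΓIso T₁ h₁).homCongr (ΓIso T₂ h₂)).trans (Equiv.ofBijective _ (bijective_Γ_map h₁ h₂)).symm)

end SpecK

namespace TropicalAffineScheme

theorem bijective_Γ_map (X Y : TropicalAffineScheme.{u}) :
    Function.Bijective fun f : X.obj ⟶ Y.obj => LocallyIdempotentSpace.Γ.map f.op := by
  obtain ⟨T₂, _, h₂, ⟨i⟩⟩ := X.property
  obtain ⟨T₁, _, h₁, ⟨j⟩⟩ := Y.property
  have key := ((((LocallyIdempotentSpace.Γ.mapIso j.op).homCongr
    (LocallyIdempotentSpace.Γ.mapIso i.op)).bijective.comp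
      (SpecK.bijective_Γ_map h₁ h₂)).comp (i.homCongr j).bijective)
  convert key using 1
  funext f
  simp [Iso.homCongr, ← Functor.map_comp, ← op_comp]

instance : Γ.{u}.Faithful where
  map_injective {X Y} f g h := by
    have := (bijective_Γ_map Y.unop X.unop).1 (a₁ := f.unop.hom) (a₂ := g.unop.hom) h
    exact Quiver.Hom.unop_inj (InducedCategory.Hom.ext this)

instance : Γ.{u}.Full where
  map_surjective {X Y} α := by
    obtain ⟨f, hf⟩ := (bijective_Γ_map Y.unop X.unop).2 α
    exact ⟨(ObjectProperty.homMk f).op, hf⟩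

theorem isRealizable_Γ (X : TropicalAffineScheme.{u}ᵒᵖ) : isRealizable (Γ.obj X) := by
  obtain ⟨T, _, h, ⟨i⟩⟩ := X.unop.property
  exact h.of_ringEquiv
    (SpecK.ΓIso T h ≪≫ LocallyIdempotentSpace.Γ.mapIso i.op).commSemiRingCatIsoToRingEquiv.symm

instance : (isRealizable.lift Γ.{u} isRealizable_Γ).rightOp.EssSurj where
  mem_essImage T := by
    let X : TropicalAffineScheme := ⟨SpecK T.unop.obj T.unop.property.isIdempotentSemiring,
      T.unop.obj, inferInstance, T.unop.property, ⟨Iso.refl _⟩⟩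
    exact ⟨X, ⟨(isRealizable.isoMk (SpecK.ΓIso T.unop.obj T.unop.property)).op⟩⟩

end TropicalAffineScheme

end

theorem theorem4p9 :
    (∃ h : ∀ X : TropicalAffineScheme.{u}ᵒᵖ, isRealizable (TropicalAffineScheme.Γ.obj X),
      (isRealizable.lift TropicalAffineScheme.Γ h).rightOp.IsEquivalence) ∧
    ∀ (T₁ T₂ : Type u) [CommSemiring T₁] [CommSemiring T₂]
      (h₁ : IsRealizable T₁) (h₂ : IsRealizable T₂) (X₁ X₂ : TropicalAffineScheme.{u}),
      Nonempty (X₁.obj ≅ SpecK T₁ h₁.isIdempotentSemiring) →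
      Nonempty (X₂.obj ≅ SpecK T₂ h₂.isIdempotentSemiring) →
      Nonempty ((T₁ →+* T₂) ≃ (X₂ ⟶ X₁)) := by
  refine ⟨⟨TropicalAffineScheme.isRealizable_Γ, { }⟩, ?_⟩
  rintro T₁ T₂ _ _ h₁ h₂ X₁ X₂ ⟨i₁⟩ ⟨i₂⟩
  exact ⟨(SpecK.homEquiv h₁ h₂).trans
    ((i₂.homCongr i₁).symm.trans isTropicalAffine.fullyFaithfulι.homEquiv.symm)⟩
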